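/- Let $E$ be a Euclidean space, $Y\subset E$ a nonempty convex compact set, $\|\cdot\|$ a norm on $E$ with conjugate norm $\|\xi\|_*=\max_{\|x\|\le1}\langle\xi,x\rangle$. Let $\omega:Y\to\mathbb R$ be continuous and convex, put $\partial\omega(y)=\{\xi\in E:\omega(z)\ge\omega(y)+\langle\xi,z-y\rangle\ \forall z\in Y\}$ and $Y^o=\{y\in Y:\partial\omega(y)\ne\emptyset\}$, and let $\omega':Y^o\to E$ be a continuous selection of $\partial\omega$ with $\langle\omega'(y)-\omega'(y'),y-y'\rangle\ge\|y-y'\|^2$ for all $y,y'\in Y^o$. Set $y_\omega=\operatorname{argmin}_Y\omega$ and $\Omega=\sqrt{2[\max_Y\omega-\min_Y\omega]}$. Let $g:Y\to E$ be a vector field with $\|g(y)\|_*\le L[g]<\infty$ for all $y\in Y$, and let $\gamma\in(0,1)$ and $\epsilon>0$. The Mirror Descent Level (MDL) method starts with $y_1=y_\omega$, $I_0=\emptyset$, $\Delta_0=+\infty$, no phase having been started. At step $t=1,2,\dots$, with $s-1$ the number of phases started so far, it puts $h_t(z)=\langle g(y_t),y_t-z\rangle$, $I_t^+=I_{t-1}\cup\{t\}$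 and solves $$\epsilon_t=\max_{y\in Y}\min_{\tau\in I_t^+}h_\tau(y),$$ obtaining $\epsilon_t$ and (any) weights $\lambda^t_\tau\ge0$, $1\le\tau\le t$, with $\lambda^t_\tau=0$ for $\tau\notin I_t^+$, $\sum_{\tau}\lambda^t_\tau=1$ and $\epsilon_t=\max_{y\in Y}\sum_{\tau}\lambda^t_\tau h_\tau(y)$. If $\epsilon_t\le\epsilon$, it terminates with output $y^t=\{y_\tau,g(y_\tau)\}_{\tau=1}^t$, $\lambda^t=\{\lambda^t_\tau\}_{\tau=1}^t$. Otherwise, if $\epsilon_t\le\gamma\Delta_{s-1}$, step $t$ starts phase $s$: $\Delta_s=\epsilon_t$, $I_t=\{\tau\le t:\lambda^t_\tau>0\}\cup\{1\}$, $\widehat y_t=y_\omega$; if $\epsilon_t>\gamma\Delta_{s-1}$, then $I_t=I_t^+$, $\widehat y_t=y_t$. In both cases $$U_t=\{y\in Y:h_\tau(y)\ge\gamma\epsilon_t\ \forall\tau\in I_t\},\qquad y_{t+1}=\operatorname*{argmin}_{y\in U_t}\left[\omega(y)-\langle\omega'(\widehat y_t),y\rangle\right],$$ and the method passes to step $t+1$.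 Then the method is well defined (the point $y_\omega$ exists and is unique; at every step that is reached $\epsilon_t$ and weights $\lambda^t$ as above exist; and if the method does not terminate at the step, $\widehat y_t\in Y^o$ and $y_{t+1}$ exists and is unique), and, whatever weights $\lambda^t$ are chosen, it terminates after finitely many steps. Its output satisfies $y_\tau\in Y$, $\lambda^t_\tau\ge0$, $\sum_{\tau=1}^t\lambda^t_\tau=1$ and $$\epsilon(y^t,\lambda^t):=\max_{y\in Y}\sum_{\tau=1}^t\lambda^t_\tau\langle g(y_\tau),y_\tau-y\rangle\le\epsilon,$$ and the number of steps (the terminal one included) does not exceed $$N=\frac{2\Omega^2L^2[g]}{\gamma^4(1-\gamma^2)\epsilon^2}+1.$$ -/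

import Mathlib

/-! Mirror Descent Level method: proximal setups, certificates, and the method itself
as a transition system on states. -/

namespace MDL

noncomputable section

variable {E : Type*} [NormedAddCommGroup E] [InnerProductSpace ℝ E]

/-- The norm conjugate to `ν`: `‖ξ‖_* = sup {⟨ξ, x⟩ : ν x ≤ 1}`. -/
def dualNorm (ν : Seminorm ℝ E) (ξ : E) : ℝ :=
  sSup ((fun x => inner ℝ ξ x) '' {x : E | ν x ≤ 1})

/-- The subdifferential at `y` of a function `ω` with domain `Y`. -/
def subdiff (Y : Set E) (ω : E → ℝ) (y : E) : Set E :=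
  {ξ | ∀ z ∈ Y, ω y + inner ℝ ξ (z - y) ≤ ω z}

/-- The set `Y^o` of points of `Y` at which `ω` has a nonempty subdifferential. -/
def subdiffDomain (Y : Set E) (ω : E → ℝ) : Set E :=
  {y ∈ Y | (subdiff Y ω y).Nonempty}

/-- `(ν, ω)` is a proximal setup for `Y`, with `ω'` the continuous selection of subgradients:
`ν` is a norm, and `ω` is continuous, convex, and strongly convex with modulus 1 w.r.t. `ν`. -/
structure IsProximalSetup (Y : Set E) (ν : Seminorm ℝ E) (ω : E → ℝ) (ω' : E → E) : Prop where
  norm_definite : ∀ x, ν x = 0 → x = 0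
  continuousOn : ContinuousOn ω Y
  convexOn : ConvexOn ℝ Y ω
  selection : ∀ y ∈ subdiffDomain Y ω, ω' y ∈ subdiff Y ω y
  selection_continuousOn : ContinuousOn ω' (subdiffDomain Y ω)
  strong : ∀ y ∈ subdiffDomain Y ω, ∀ y' ∈ subdiffDomain Y ω,
    ν (y - y') ^ 2 ≤ inner ℝ (ω' y - ω' y') (y - y')

/-- `x` is a minimizer of `f` over `S`. -/
def IsArgmin (S : Set E) (f : E → ℝ) (x : E) : Prop :=
  x ∈ S ∧ ∀ z ∈ S, f x ≤ f z

/-- The `ω`-diameter `Ω = √(2 [max_Y ω - min_Y ω])` of `Y`. -/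
def omegaDiam (Y : Set E) (ω : E → ℝ) : ℝ :=
  Real.sqrt (2 * (sSup (ω '' Y) - sInf (ω '' Y)))

/-- The affine function `h_y(z) = ⟨g(y), y - z⟩`. -/
def affineAt (g : E → E) (y z : E) : ℝ := inner ℝ (g y) (y - z)

/-- The values, as `z` ranges over `Y`, of `∑_{τ = 1}^t λ_τ ⟨g(y_τ), y_τ - z⟩`. -/
def certificateValues (Y : Set E) (g : E → E) (t : ℕ) (y : ℕ → E) (lam : ℕ → ℝ) : Set ℝ :=
  (fun z => ∑ τ ∈ Finset.Icc 1 t, lam τ * affineAt g (y τ) z) '' Y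

/-- The weights `λ_1, …, λ_t` form an accuracy certificate. -/
def IsCertificate (t : ℕ) (lam : ℕ → ℝ) : Prop :=
  (∀ τ ∈ Finset.Icc 1 t, 0 ≤ lam τ) ∧ ∑ τ ∈ Finset.Icc 1 t, lam τ = 1

/-- The resolution of the certificate `λ_1, …, λ_t` at the protocol `(y_τ, g(y_τ))_{τ = 1}^t`. -/
def resolution (Y : Set E) (g : E → E) (t : ℕ) (y : ℕ → E) (lam : ℕ → ℝ) : ℝ :=
  sSup (certificateValues Y g t y lam)

/-- What the method remembers when it enters step `t`. -/
structure State (E : Type*) where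
  /-- the number of the step that is entered -/
  t : ℕ
  /-- the search points `y_1, …, y_t`; other values are irrelevant -/
  y : ℕ → E
  /-- the index set `I_{t-1}` -/
  I : Finset ℕ
  /-- the optimality gap of the latest phase started before step `t` (`+∞` if there is none) -/
  gap : EReal

/-- The state in which step 1 is entered: `y_1 = y_ω`, `I_0 = ∅`, `Δ_0 = +∞`. -/
def initState (yω : E) : State E := ⟨1, fun _ => yω, ∅, ⊤⟩

/-- The index set `I_t^+ = I_{t-1} ∪ {t}`. -/
def State.Iplus (σ : State E) : Finset ℕ := insert σ.t σ.I

/-- `(e, lam)` is an outcome of solving the auxiliary problem of step `t`: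
`e = ε_t = max_{z ∈ Y} min_{τ ∈ I_t^+} h_τ(z)`, and `lam = λ^t` consists of nonnegative weights
supported on `I_t^+`, of sum 1, such that `ε_t = max_{z ∈ Y} ∑_{τ ∈ I_t^+} λ^t_τ h_τ(z)`. -/
structure SolvesAux (Y : Set E) (g : E → E) (σ : State E) (e : ℝ) (lam : ℕ → ℝ) : Prop where
  value : IsGreatest
    ((fun z => σ.Iplus.inf' (Finset.insert_nonempty _ _) (fun τ => affineAt g (σ.y τ) z)) '' Y) e
  nonneg : ∀ τ, 0 ≤ lam τ
  support : ∀ τ, τ ∉ σ.Iplus → lam τ = 0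
  sum_eq_one : ∑ τ ∈ σ.Iplus, lam τ = 1
  weights : IsGreatest ((fun z => ∑ τ ∈ σ.Iplus, lam τ * affineAt g (σ.y τ) z) '' Y) e

/-- Step `t` starts a new phase: `ε_t ≤ γ Δ` with `Δ` the gap of the latest phase. -/
def StartsPhase (γ : ℝ) (σ : State E) (e : ℝ) : Prop := (e : EReal) ≤ (γ : EReal) * σ.gap

open Classical in
/-- The index set `I_t`. -/
def newI (γ : ℝ) (σ : State E) (e : ℝ) (lam : ℕ → ℝ) : Finset ℕ :=
  if StartsPhase γ σ e then (Finset.Icc 1 σ.t).filter (fun τ => 0 < lam τ) ∪ {1} else σ.Iplus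

open Classical in
/-- The gap of the phase to which step `t` belongs. -/
def newGap (γ : ℝ) (σ : State E) (e : ℝ) : EReal :=
  if StartsPhase γ σ e then (e : EReal) else σ.gap

open Classical in
/-- The point `ŷ_t` that is projected at step `t`. -/
def proxCenter (γ : ℝ) (yω : E) (σ : State E) (e : ℝ) : E :=
  if StartsPhase γ σ e then yω else σ.y σ.t

/-- The level set `U_t = {z ∈ Y : h_τ(z) ≥ γ ε_t for all τ ∈ I_t}`. -/
def levelSet (Y : Set E) (g : E → E) (γ : ℝ) (σ : State E) (e : ℝ) (lam : ℕ → ℝ) : Set E :=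
  {z ∈ Y | ∀ τ ∈ newI γ σ e lam, γ * e ≤ affineAt g (σ.y τ) z}

/-- A nonterminal step: in state `σ` the auxiliary problem is solved with outcome `(e, lam)`,
`e = ε_t > ε`, and the method proceeds to the state `σ'`, whose new search point `y_{t+1}` is the
`ω`-projection of `ŷ_t` on the level set `U_t`. -/
structure Step (Y : Set E) (ω : E → ℝ) (ω' : E → E) (g : E → E) (γ ε : ℝ) (yω : E)
    (σ : State E) (e : ℝ) (lam : ℕ → ℝ) (σ' : State E) : Prop where
  solves : SolvesAux Y g σ e lam
  not_done : ε < e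
  center_mem : proxCenter γ yω σ e ∈ subdiffDomain Y ω
  t_eq : σ'.t = σ.t + 1
  y_old : ∀ τ, τ ≠ σ.t + 1 → σ'.y τ = σ.y τ
  y_new : IsArgmin (levelSet Y g γ σ e lam)
    (fun z => ω z - inner ℝ (ω' (proxCenter γ yω σ e)) z) (σ'.y (σ.t + 1))
  I_eq : σ'.I = newI γ σ e lam
  gap_eq : σ'.gap = newGap γ σ e

/-- The states that the method can enter, whatever optimal weights `λ^t` the solver of the
auxiliary problems returns. -/
inductive Reachable (Y : Set E) (ω : E → ℝ) (ω' : E → E) (g : E → E) (γ ε : ℝ) (yω : E) :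
    State E → Prop
  | init : Reachable Y ω ω' g γ ε yω (initState yω)
  | step {σ σ' : State E} {e : ℝ} {lam : ℕ → ℝ} :
      Reachable Y ω ω' g γ ε yω σ → Step Y ω ω' g γ ε yω σ e lam σ' →
      Reachable Y ω ω' g γ ε yω σ'

/-- The method can terminate in state `σ` (that is, at step `σ.t`) with output
`(y_τ, g(y_τ))_{τ = 1}^t` and `λ^t = lam`: the step is entered, the auxiliary problem is solved
with outcome `(e, lam)`, and `e = ε_t ≤ ε`. -/
def TerminatesAt (Y : Set E) (ω : E → ℝ) (ω' : E → E) (g : E → E) (γ ε : ℝ) (yω : E)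
    (σ : State E) (lam : ℕ → ℝ) : Prop :=
  Reachable Y ω ω' g γ ε yω σ ∧ ∃ e, SolvesAux Y g σ e lam ∧ e ≤ ε

end

end MDL

/-! The potential is the Bregman distance `V_y(u) = ω(u) - ω(y) - ⟨ω'(y), u - y⟩`. In a phase with
gap `Δ`, every nonterminal step has `γΔ < e ≤ Δ`, so a point `u` of `Y` at which all cuts are at
least `γΔ` lies in all level sets of the phase. A prox step from the center `c` to `x` satisfies
`V_x(u) + V_c(x) ≤ V_c(u)`. The cut generated at `c` is among the constraints, so `γe ≤ L‖x - c‖`;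
since `‖x - c‖² ≤ 4 V_c(x)`, the quantity `4L²V` drops by at least `γ²e² ≥ γ⁴Δ²`. It starts at no
more than `2Ω²L²`, which bounds the length of the phase by `2Ω²L²/(γ⁴Δ²)`. Gaps shrink by the factor
`γ` or better from phase to phase and stay above `ε`; a geometric series gives the factor `1/(1 -
γ²)`.

The delicate point is the optimality condition, stated with the selection `ω'` although
subdifferentials can be unbounded on the boundary. A theorem of the alternative with Slater's
condition yields some subgradient at the minimizer, and `inner_le_selection` (continuity of `ω'`)
lets `ω'` replace it. The same alternative yields the weights of the auxiliary problem. -/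

namespace MDL

open Filter Topology

/-! ### Theorem of the alternative -/

/-- A theorem of the alternative: if at each point of a convex set one of finitely many convex
functions is nonnegative, then some convex combination of them is nonnegative on the set. -/
theorem exists_weights_of_forall_exists_nonneg {E ι : Type*} [AddCommGroup E] [Module ℝ E]
    [Fintype ι] {Y : Set E} (hYne : Y.Nonempty) {Φ : ι → E → ℝ}
    (hΦ : ∀ i, ConvexOn ℝ Y (Φ i)) (h : ∀ z ∈ Y, ∃ i, 0 ≤ Φ i z) :
    ∃ c : ι → ℝ, (∀ i, 0 ≤ c i) ∧ ∑ i, c i = 1 ∧ ∀ z ∈ Y, 0 ≤ ∑ i, c i * Φ i z := by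
  classical
  obtain ⟨z₀, hz₀⟩ := hYne
  obtain ⟨i₀, -⟩ := h z₀ hz₀
  have hYc : Convex ℝ Y := (hΦ i₀).1
  -- The open negative orthant misses the vectors that dominate some `(Φ i z)ᵢ`; the coefficients of
  -- a separating functional, normalized, are the weights.
  set s : Set (ι → ℝ) := Set.pi Set.univ fun _ => Set.Iio 0 with hs
  set t : Set (ι → ℝ) := {v | ∃ z ∈ Y, ∀ i, Φ i z ≤ v i} with ht
  have hsc : Convex ℝ s := convex_pi fun _ _ => convex_Iio 0
  have hso : IsOpen s := isOpen_set_pi Set.finite_univ fun _ _ => isOpen_Iio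
  have htc : Convex ℝ t := by
    rintro v ⟨x, hx, hv⟩ w ⟨y, hy, hw⟩ a b ha hb hab
    refine ⟨a • x + b • y, hYc hx hy ha hb hab, fun i => ?_⟩
    have h1 := (hΦ i).2 hx hy ha hb hab
    have h2 := mul_le_mul_of_nonneg_left (hv i) ha
    have h3 := mul_le_mul_of_nonneg_left (hw i) hb
    simp only [smul_eq_mul, Pi.add_apply, Pi.smul_apply] at *
    linarith
  have hd : Disjoint s t := by
    rw [Set.disjoint_left]
    rintro v hv ⟨z, hz, hvz⟩
    obtain ⟨i, hi⟩ := h z hz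
    have := hv i trivial
    simp only [Set.mem_Iio] at this
    linarith [hvz i]
  obtain ⟨f, u, hfs, hft⟩ := geometric_hahn_banach_open hsc hso htc hd
  have hf : ∀ v : ι → ℝ, f v = ∑ i, v i * f (Pi.single i 1) := fun v => by
    conv_lhs => rw [pi_eq_sum_univ' v]
    simp [map_sum, Pi.single]
  -- Two uses: small `δ` with `n = 0` shows `0 ≤ u`, and large `n` excludes a negative coefficient.
  have hone : ∀ δ : ℝ, 0 < δ → ∀ n : ℝ, 0 ≤ n → ∀ i,
      δ * f (fun _ => -1) - n * f (Pi.single i 1) < u := by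
    intro δ hδ n hn i
    have : δ • (fun _ => (-1 : ℝ)) - n • Pi.single i (1 : ℝ) ∈ s := by
      intro j _
      have : 0 ≤ n * (Pi.single i (1 : ℝ) : ι → ℝ) j :=
        mul_nonneg hn (by by_cases hj : j = i <;> simp [hj])
      simp only [Set.mem_Iio, Pi.sub_apply, Pi.smul_apply, smul_eq_mul]
      linarith
    simpa using hfs _ this
  have hu : 0 ≤ u := by
    by_contra! hu
    have h1 := hone (-u / (2 * (1 + |f (fun _ => -1)|))) (div_pos (by linarith) (by positivity))
      0 le_rfl i₀
    have h2 : |f (fun _ => -1)| / (1 + |f (fun _ => -1)|) ≤ 1 :=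
      (div_le_one (by positivity)).2 (by linarith)
    have h3 : -u / (2 * (1 + |f (fun _ => -1)|)) * |f (fun _ => -1)|
        = (-u / 2) * (|f (fun _ => -1)| / (1 + |f (fun _ => -1)|)) := by field_simp
    have h4 : 0 ≤ -u / (2 * (1 + |f (fun _ => -1)|)) := div_nonneg (by linarith) (by positivity)
    nlinarith [neg_abs_le (f (fun _ => -1))]
  have hnn : ∀ i, 0 ≤ f (Pi.single i 1) := by
    intro i
    by_contra! hi
    have h1 := hone 1 one_pos ((u + |f (fun _ => -1)|) / (-f (Pi.single i 1)))
      (div_nonneg (by positivity) (by linarith)) i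
    have h2 : (u + |f (fun _ => -1)|) / (-f (Pi.single i 1)) * f (Pi.single i 1)
        = -(u + |f (fun _ => -1)|) := by
      rw [div_neg, neg_mul, div_mul_cancel₀ _ hi.ne]
    rw [h2] at h1
    linarith [neg_abs_le (f (fun _ => -1))]
  set S := ∑ i, f (Pi.single i 1) with hS
  have hSpos : 0 < S := by
    refine lt_of_le_of_ne (Finset.sum_nonneg fun i _ => hnn i) fun h0 => ?_
    have h1 : ∀ i, f (Pi.single i 1) = 0 := fun i =>
      (Finset.sum_eq_zero_iff_of_nonneg fun i _ => hnn i).1 h0.symm i (Finset.mem_univ i)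
    have h2 : ∀ v, f v = 0 := fun v => by rw [hf]; simp [h1]
    have h3 := hone 1 one_pos 0 le_rfl i₀
    have h4 := hft (fun i => Φ i z₀) ⟨z₀, hz₀, fun i => le_rfl⟩
    rw [h2] at h3 h4
    simp at h3
    linarith
  refine ⟨fun i => f (Pi.single i 1) / S, fun i => div_nonneg (hnn i) hSpos.le, ?_, fun z hz => ?_⟩
  · rw [← Finset.sum_div, ← hS, div_self hSpos.ne']
  · have h4 := hft (fun i => Φ i z) ⟨z, hz, fun i => le_rfl⟩
    rw [hf] at h4
    have : ∑ i, f (Pi.single i 1) / S * Φ i z = (∑ i, Φ i z * f (Pi.single i 1)) / S := by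
      rw [Finset.sum_div]
      exact Finset.sum_congr rfl fun i _ => by ring
    rw [this]
    exact div_nonneg (hu.trans h4) hSpos.le

/-! ### Existence of subgradients -/

section

variable {E : Type*} [NormedAddCommGroup E] [InnerProductSpace ℝ E]

/-- An affine minorant near `y` is an affine minorant on the domain of a convex function. -/
theorem mem_subdiff_of_local {Y : Set E} {ω : E → ℝ} (hω : ConvexOn ℝ Y ω) {y ξ : E}
    (hy : y ∈ Y) {δ : ℝ} (hδ : 0 < δ)
    (h : ∀ z ∈ Y, ‖z - y‖ < δ → ω y + inner ℝ ξ (z - y) ≤ ω z) : ξ ∈ subdiff Y ω y := by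
  intro z hz
  -- With this `s` the point `y + s (z - y)` is within `δ` of `y`; convexity carries the inequality
  -- on to `z`.
  set s : ℝ := δ / (δ + ‖z - y‖) with hs
  have hden : 0 < δ + ‖z - y‖ := by positivity
  have hs0 : 0 < s := by positivity
  have hs1 : s ≤ 1 := (div_le_one hden).2 (by linarith [norm_nonneg (z - y)])
  have hpt : (1 - s) • y + s • z - y = s • (z - y) := by module
  have h1 := hω.2 hy hz (sub_nonneg.2 hs1) hs0.le (by ring)
  have h2 := h _ (hω.1 hy hz (sub_nonneg.2 hs1) hs0.le (by ring)) (by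
    rw [hpt, norm_smul, Real.norm_of_nonneg hs0.le, hs, div_mul_eq_mul_div, div_lt_iff₀ hden]
    nlinarith)
  rw [hpt, inner_smul_right] at h2
  simp only [smul_eq_mul] at h1
  have h3 : s * (ω y + inner ℝ ξ (z - y)) ≤ s * ω z := by linarith
  exact le_of_mul_le_mul_left h3 hs0

/-- A continuous convex function has a subgradient at any relative interior point. -/
theorem subdiff_nonempty_of_ball [FiniteDimensional ℝ E] {Y : Set E} {ω : E → ℝ}
    (hω : ConvexOn ℝ Y ω) (hc : ContinuousOn ω Y) {y : E} (hy : y ∈ Y) {δ : ℝ} (hδ : 0 < δ)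
    (h : ∀ w ∈ vectorSpan ℝ Y, ‖w‖ < δ → y + w ∈ Y) : (subdiff Y ω y).Nonempty := by
  set W := vectorSpan ℝ Y with hW
  have hmem : ∀ w ∈ Metric.ball (0 : W) δ, y + (w : E) ∈ Y := fun w hw =>
    h w w.2 (by simpa using hw)
  -- The strict epigraph is taken over the direction space of `Y`, where it is open even if `Y` has
  -- empty interior in `E`.
  set B : Set (W × ℝ) := {p | p.1 ∈ Metric.ball (0 : W) δ ∧ ω (y + p.1) < p.2} with hB
  have hBo : IsOpen B := by
    have hcont : ContinuousOn (fun p : W × ℝ => p.2 - ω (y + p.1))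
        (Prod.fst ⁻¹' Metric.ball (0 : W) δ) := by
      refine continuousOn_snd.sub (hc.comp (by fun_prop) fun p hp => hmem _ hp)
    have := hcont.isOpen_inter_preimage (Metric.isOpen_ball.preimage continuous_fst)
      (isOpen_Ioi (a := (0 : ℝ)))
    convert this using 1
    ext p
    simp [hB]
  have hBc : Convex ℝ B := by
    rintro ⟨v, a⟩ ⟨hv, hva⟩ ⟨w, b⟩ ⟨hw, hwb⟩ p q hp hq hpq
    refine ⟨convex_ball _ _ hv hw hp hq hpq, ?_⟩
    have h1 := hω.2 (hmem v hv) (hmem w hw) hp hq hpq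
    have h2 : p • (y + (v : E)) + q • (y + (w : E)) = y + (p • (v : E) + q • (w : E)) := by
      have : y = (p + q) • y := by rw [hpq, one_smul]
      conv_rhs => rw [this]
      module
    rw [h2] at h1
    simp only [smul_eq_mul] at h1
    simp only [Prod.smul_mk, Prod.mk_add_mk, Submodule.coe_add, Submodule.coe_smul, smul_eq_mul]
    refine h1.trans_lt ?_
    rcases hp.eq_or_lt with rfl | hp'
    · have : q = 1 := by linarith
      subst this
      simpa using hwb
    · have := mul_lt_mul_of_pos_left hva hp'
      have := mul_le_mul_of_nonneg_left hwb.le hq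
      simp only at *
      linarith
  have hnot : ((0 : W), ω y) ∉ B := fun hh => by
    have := hh.2
    simp at this
  obtain ⟨φ, hφ⟩ := geometric_hahn_banach_open_point hBc hBo hnot
  have hsplit : ∀ (w : W) (a : ℝ), φ (w, a) = φ (w, 0) + a * φ (0, 1) := fun w a => by
    have : ((w, a) : W × ℝ) = (w, 0) + a • ((0 : W), (1 : ℝ)) := by simp
    rw [this, map_add, map_smul, smul_eq_mul]
  -- The hyperplane is not vertical: `B` has points straight above `(0, ω y)`.
  have hneg : φ (0, 1) < 0 := by
    have h1 := hφ (0, ω y + 1) ⟨by simpa using hδ, by simp⟩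
    rw [hsplit, hsplit 0 (ω y)] at h1
    linarith
  have hle : ∀ w ∈ Metric.ball (0 : W) δ, φ (w, 0) / (-φ (0, 1)) + ω y ≤ ω (y + w) := by
    intro w hw
    refine le_of_forall_pos_le_add fun η hη => ?_
    have h1 := hφ (w, ω (y + w) + η) ⟨hw, by simpa using hη⟩
    rw [hsplit, hsplit 0 (ω y), show ((0 : W), (0 : ℝ)) = 0 from rfl, map_zero, zero_add] at h1
    have h2 : φ (w, 0) / (-φ (0, 1)) ≤ ω (y + w) + η - ω y := by
      rw [div_le_iff₀ (by linarith)]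
      linarith
    linarith
  set ψ : StrongDual ℝ W := (-φ (0, 1))⁻¹ • φ.comp (ContinuousLinearMap.inl ℝ W ℝ) with hψ
  set ξ : W := (InnerProductSpace.toDual ℝ W).symm ψ with hξ
  refine ⟨ξ, mem_subdiff_of_local hω hy hδ fun z hz hzy => ?_⟩
  have hzW : z - y ∈ W := vsub_mem_vectorSpan ℝ hz hy
  have h1 := hle ⟨z - y, hzW⟩ (by simpa using hzy)
  have h2 : inner ℝ (ξ : E) (z - y) = φ (⟨z - y, hzW⟩, 0) / (-φ (0, 1)) := by
    have : inner ℝ ξ (⟨z - y, hzW⟩ : W) = ψ ⟨z - y, hzW⟩ :=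
      InnerProductSpace.toDual_symm_apply
    rw [Submodule.coe_inner] at this
    rw [this, hψ]
    simp [div_eq_inv_mul]
  rw [h2]
  simpa [add_comm] using h1

/-- There is a point such that all points of `Y` are limits of points of `Y^o` along the segments
that join them to this point. -/
theorem exists_segments_subset_subdiffDomain [FiniteDimensional ℝ E] {Y : Set E} {ω : E → ℝ}
    (hYne : Y.Nonempty) (hω : ConvexOn ℝ Y ω) (hc : ContinuousOn ω Y) :
    ∃ x₀ ∈ Y, ∀ z ∈ Y, ∀ θ : ℝ, 0 < θ → θ ≤ 1 →
      (1 - θ) • z + θ • x₀ ∈ subdiffDomain Y ω := by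
  obtain ⟨x₀, hx₀⟩ := Set.Nonempty.intrinsicInterior hω.1 hYne
  have hx₀Y := intrinsicInterior_subset hx₀
  obtain ⟨x, hx, rfl⟩ := mem_intrinsicInterior.1 hx₀
  obtain ⟨r, hr, hball⟩ := Metric.mem_nhds_iff.1 (mem_interior_iff_mem_nhds.1 hx)
  refine ⟨x, hx₀Y, fun z hz θ hθ hθ1 => ?_⟩
  have hmem : (1 - θ) • z + θ • (x : E) ∈ Y :=
    hω.1 hz hx₀Y (sub_nonneg.2 hθ1) hθ.le (by ring)
  -- The homothety with center `z` and ratio `θ` shrinks the relative ball of radius `r` about `x`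
  -- to radius `θ r`.
  refine ⟨hmem, subdiff_nonempty_of_ball hω hc hmem (mul_pos hθ hr) fun w hw hwr => ?_⟩
  have hw' : θ⁻¹ • w ∈ (affineSpan ℝ Y).direction := by
    rw [direction_affineSpan]
    exact Submodule.smul_mem _ _ hw
  have hxw : (x : E) + θ⁻¹ • w ∈ affineSpan ℝ Y := by
    have := AffineSubspace.vadd_mem_of_mem_direction hw' x.2
    rwa [vadd_eq_add, add_comm] at this
  have hxY : (x : E) + θ⁻¹ • w ∈ Y := by
    have : (⟨(x : E) + θ⁻¹ • w, hxw⟩ : affineSpan ℝ Y) ∈ Metric.ball x r := by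
      rw [Metric.mem_ball, Subtype.dist_eq, dist_eq_norm, add_sub_cancel_left, norm_smul,
        norm_inv, Real.norm_of_nonneg hθ.le, inv_mul_lt_iff₀ hθ]
      exact hwr
    exact hball this
  have := hω.1 hz hxY (sub_nonneg.2 hθ1) hθ.le (by ring)
  convert this using 1
  rw [smul_add, smul_smul, mul_inv_cancel₀ hθ.ne', one_smul]
  abel

end

end MDL

namespace MDL

open Filter Topology

variable {E : Type*} [NormedAddCommGroup E] [InnerProductSpace ℝ E]

/-- A segment between boundary points may leave `Y^o`; a small admixture of `x₀` pushes it inside,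
where `ω'` is a subgradient. -/
theorem exists_triangles_subset_subdiffDomain [FiniteDimensional ℝ E] {Y : Set E} {ω : E → ℝ}
    (hYne : Y.Nonempty) (hω : ConvexOn ℝ Y ω) (hc : ContinuousOn ω Y) :
    ∃ x₀ ∈ Y, ∀ a ∈ Y, ∀ b ∈ Y, ∀ p q r : ℝ, 0 ≤ p → 0 ≤ q → 0 < r → p + q + r = 1 →
      p • a + q • b + r • x₀ ∈ subdiffDomain Y ω := by
  obtain ⟨x₀, hx₀, h⟩ := exists_segments_subset_subdiffDomain hYne hω hc
  refine ⟨x₀, hx₀, fun a ha b hb p q r hp hq hr hpqr => ?_⟩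
  rcases (add_nonneg hp hq).eq_or_lt with h0 | h0
  · have hp0 : p = 0 := by linarith
    have hq0 : q = 0 := by linarith
    have hr1 : r = 1 := by linarith
    simpa [hp0, hq0, hr1] using h a ha 1 one_pos le_rfl
  · have hz : (p / (p + q)) • a + (q / (p + q)) • b ∈ Y :=
      hω.1 ha hb (by positivity) (by positivity) (by field_simp)
    have := h _ hz r hr (by linarith)
    convert this using 2
    rw [show 1 - r = p + q by linarith, smul_add, smul_smul, smul_smul, mul_div_cancel₀ _ h0.ne',
      mul_div_cancel₀ _ h0.ne']

/-! ### The norm and its conjugate -/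

theorem seminorm_continuous [FiniteDimensional ℝ E] (ν : Seminorm ℝ E) : Continuous ν :=
  continuousOn_univ.1 (ν.convexOn.continuousOn isOpen_univ)

theorem exists_norm_le_mul_seminorm [FiniteDimensional ℝ E] {ν : Seminorm ℝ E}
    (hν : ∀ x, ν x = 0 → x = 0) : ∃ C : ℝ, ∀ x, ‖x‖ ≤ C * ν x := by
  rcases (Metric.sphere (0 : E) 1).eq_empty_or_nonempty with h | h
  · refine ⟨0, fun x => ?_⟩
    by_contra! hx
    rw [zero_mul] at hx
    have : ‖x‖⁻¹ • x ∈ Metric.sphere (0 : E) 1 := by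
      simp [norm_smul, hx.ne']
    simp [h] at this
  · obtain ⟨v, hv, hmin⟩ := (isCompact_sphere (0 : E) 1).exists_isMinOn h
      (seminorm_continuous ν).continuousOn
    have hv0 : 0 < ν v := by
      refine lt_of_le_of_ne (apply_nonneg ν v) fun h0 => ?_
      rw [hν v h0.symm] at hv
      simp at hv
    refine ⟨(ν v)⁻¹, fun x => ?_⟩
    rcases eq_or_ne x 0 with rfl | hx
    · simp
    have hx' : 0 < ‖x‖ := norm_pos_iff.2 hx
    have h1 : ν v ≤ ν (‖x‖⁻¹ • x) := hmin (by simp [norm_smul, hx'.ne'])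
    rw [map_smul_eq_mul, norm_inv, norm_norm, le_inv_mul_iff₀ hx'] at h1
    rw [le_inv_mul_iff₀ hv0]
    linarith

theorem bddAbove_dualNorm [FiniteDimensional ℝ E] {ν : Seminorm ℝ E}
    (hν : ∀ x, ν x = 0 → x = 0) (ξ : E) :
    BddAbove ((fun x => inner ℝ ξ x) '' {x : E | ν x ≤ 1}) := by
  obtain ⟨C, hC⟩ := exists_norm_le_mul_seminorm hν
  refine ⟨‖ξ‖ * |C|, ?_⟩
  rintro _ ⟨x, hx, rfl⟩
  refine (real_inner_le_norm ξ x).trans (mul_le_mul_of_nonneg_left ?_ (norm_nonneg ξ))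
  have hx' : ν x ≤ 1 := hx
  nlinarith [hC x, le_abs_self C, abs_nonneg C, apply_nonneg ν x]

theorem inner_le_dualNorm_mul [FiniteDimensional ℝ E] {ν : Seminorm ℝ E}
    (hν : ∀ x, ν x = 0 → x = 0) (ξ x : E) : inner ℝ ξ x ≤ dualNorm ν ξ * ν x := by
  rcases (apply_nonneg ν x).eq_or_lt with h | h
  · simp [hν x h.symm]
  · have h1 : inner ℝ ξ ((ν x)⁻¹ • x) ≤ dualNorm ν ξ :=
      le_csSup (bddAbove_dualNorm hν ξ) ⟨_, by
        simp [map_smul_eq_mul, abs_of_pos h, h.ne'], rfl⟩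
    rw [inner_smul_right, inv_mul_le_iff₀ h] at h1
    linarith

/-! ### The selection and Bregman distances -/

/-- A continuous selection of the subdifferential is maximal along `Y` among subgradients. -/
theorem IsProximalSetup.inner_le_selection [FiniteDimensional ℝ E] {Y : Set E}
    {ν : Seminorm ℝ E} {ω : E → ℝ} {ω' : E → E} (hω : IsProximalSetup Y ν ω ω') {y ξ z : E}
    (hy : y ∈ Y) (hξ : ξ ∈ subdiff Y ω y) (hz : z ∈ Y) :
    inner ℝ ξ (z - y) ≤ inner ℝ (ω' y) (z - y) := by
  have hyo : y ∈ subdiffDomain Y ω := ⟨hy, ξ, hξ⟩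
  obtain ⟨x₀, hx₀, hx⟩ :=
    exists_triangles_subset_subdiffDomain ⟨y, hy⟩ hω.convexOn hω.continuousOn
  -- Adding the subgradient inequalities at `y` and at `y + θ w` compares `ξ` with `ω' (y + θ w)`;
  -- continuity of `ω'` allows `θ → 0`. Afterwards `η → 0` recovers `z`.
  have hstep : ∀ η : ℝ, 0 < η → η < 1 →
      inner ℝ ξ ((1 - η) • z + η • x₀ - y) ≤ inner ℝ (ω' y) ((1 - η) • z + η • x₀ - y) := by
    intro η hη hη1
    set w := (1 - η) • z + η • x₀ - y with hw
    have hpath : ∀ θ ∈ Set.Ioo (0 : ℝ) 1, y + θ • w ∈ subdiffDomain Y ω := by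
      intro θ hθ
      have := hx y hy z hz (1 - θ) (θ * (1 - η)) (θ * η) (by linarith [hθ.2])
        (mul_nonneg hθ.1.le (by linarith)) (mul_pos hθ.1 hη) (by ring)
      convert this using 1
      rw [hw]
      module
    have hev : ∀ᶠ θ in 𝓝[>] (0 : ℝ), θ ∈ Set.Ioo (0 : ℝ) 1 :=
      Ioo_mem_nhdsGT one_pos
    have hlim : Tendsto (fun θ : ℝ => y + θ • w) (𝓝[>] 0) (𝓝[subdiffDomain Y ω] y) := by
      refine tendsto_nhdsWithin_iff.2 ⟨?_, hev.mono fun θ hθ => hpath θ hθ⟩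
      have : Continuous fun θ : ℝ => y + θ • w := by fun_prop
      simpa using (this.tendsto 0).mono_left nhdsWithin_le_nhds
    have hlim' := Tendsto.inner (𝕜 := ℝ)
      ((hω.selection_continuousOn y hyo).tendsto.comp hlim) (tendsto_const_nhds (x := w))
    refine ge_of_tendsto hlim' (hev.mono fun θ hθ => ?_)
    have h1 := hω.selection _ (hpath θ hθ) y hy
    have h2 := hξ _ (hpath θ hθ).1
    rw [show y - (y + θ • w) = (-θ) • w by module, inner_smul_right] at h1
    rw [add_sub_cancel_left, inner_smul_right] at h2
    have h3 : θ * inner ℝ ξ w ≤ θ * inner ℝ (ω' (y + θ • w)) w := by linarith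
    exact le_of_mul_le_mul_left h3 hθ.1
  have hlim : ∀ ζ : E, Tendsto (fun η : ℝ => inner ℝ ζ ((1 - η) • z + η • x₀ - y)) (𝓝[>] 0)
      (𝓝 (inner ℝ ζ (z - y))) := fun ζ => by
    have : Continuous fun η : ℝ => inner ℝ ζ ((1 - η) • z + η • x₀ - y) := by fun_prop
    simpa using (this.tendsto 0).mono_left nhdsWithin_le_nhds
  have hev : ∀ᶠ η in 𝓝[>] (0 : ℝ), η ∈ Set.Ioo (0 : ℝ) 1 := Ioo_mem_nhdsGT one_pos
  exact le_of_tendsto_of_tendsto (hlim ξ) (hlim (ω' y)) (hev.mono fun η hη => hstep η hη.1 hη.2)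

/-- The Bregman distance `V_y(z) = ω(z) - ω(y) - ⟨ω'(y), z - y⟩`. -/
noncomputable def bregman (ω : E → ℝ) (ω' : E → E) (y z : E) : ℝ :=
  ω z - ω y - inner ℝ (ω' y) (z - y)

/-- Strong convexity bounds the Bregman distance from below. -/
theorem IsProximalSetup.sq_le_bregman [FiniteDimensional ℝ E] {Y : Set E}
    {ν : Seminorm ℝ E} {ω : E → ℝ} {ω' : E → E} (hω : IsProximalSetup Y ν ω ω') {y z : E}
    (hy : y ∈ subdiffDomain Y ω) (hz : z ∈ Y) :
    ν (z - y) ^ 2 ≤ 4 * bregman ω ω' y z := by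
  obtain ⟨x₀, hx₀, hx⟩ :=
    exists_triangles_subset_subdiffDomain ⟨z, hz⟩ hω.convexOn hω.continuousOn
  have hmemY : ∀ η ∈ Set.Ioo (0 : ℝ) 1, (1 - η) • z + η • x₀ ∈ Y := fun η hη =>
    hω.convexOn.1 hz hx₀ (by linarith [hη.2]) hη.1.le (by ring)
  have hstep : ∀ η ∈ Set.Ioo (0 : ℝ) 1,
      ν ((1 - η) • z + η • x₀ - y) ^ 2 ≤ 4 * bregman ω ω' y ((1 - η) • z + η • x₀) := by
    intro η hη
    set w := (1 - η) • z + η • x₀ with hw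
    -- One midpoint is enough: subgradient inequalities from `m` to `w` and from `y` to `m` add up
    -- to `bregman ω ω' y w ≥ ν (m - y) ^ 2`. This gives the factor 4.
    have hm : y + (1 / 2 : ℝ) • (w - y) ∈ subdiffDomain Y ω := by
      have := hx y hy.1 z hz (1 / 2) ((1 - η) / 2) (η / 2) (by norm_num) (by linarith [hη.2])
        (by linarith [hη.1]) (by ring)
      convert this using 1
      rw [hw]
      module
    set m := y + (1 / 2 : ℝ) • (w - y) with hmdef
    have h1 := hω.selection m hm w (hmemY η hη)
    have h2 := hω.selection y hy m hm.1
    have h3 := hω.strong m hm y hy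
    have e1 : w - m = (1 / 2 : ℝ) • (w - y) := by rw [hmdef]; module
    have e2 : m - y = (1 / 2 : ℝ) • (w - y) := by rw [hmdef]; module
    rw [e1, inner_smul_right] at h1
    rw [e2, inner_smul_right] at h2
    rw [e2, inner_smul_right, map_smul_eq_mul, inner_sub_left, Real.norm_of_nonneg (by norm_num),
      mul_pow] at h3
    rw [bregman]
    linarith
  have hev : ∀ᶠ η in 𝓝[>] (0 : ℝ), η ∈ Set.Ioo (0 : ℝ) 1 := Ioo_mem_nhdsGT one_pos
  have hlim : Tendsto (fun η : ℝ => (1 - η) • z + η • x₀) (𝓝[>] 0) (𝓝[Y] z) := by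
    refine tendsto_nhdsWithin_iff.2 ⟨?_, hev.mono hmemY⟩
    have : Continuous fun η : ℝ => (1 - η) • z + η • x₀ := by fun_prop
    simpa using (this.tendsto 0).mono_left nhdsWithin_le_nhds
  have hν := seminorm_continuous ν
  have hc1 : ContinuousWithinAt (fun w => ν (w - y) ^ 2) Y z := by fun_prop
  have hc2 : ContinuousWithinAt (fun w => 4 * bregman ω ω' y w) Y z := by
    have := hω.continuousOn z hz
    unfold bregman
    fun_prop
  exact le_of_tendsto_of_tendsto (hc1.tendsto.comp hlim) (hc2.tendsto.comp hlim) (hev.mono hstep)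

theorem IsArgmin.zero_mem_subdiff {Y : Set E} {ω : E → ℝ} {y : E} (h : IsArgmin Y ω y) :
    (0 : E) ∈ subdiff Y ω y := fun z hz => by simpa using h.2 z hz

theorem IsArgmin.mem_subdiffDomain {Y : Set E} {ω : E → ℝ} {y : E} (h : IsArgmin Y ω y) :
    y ∈ subdiffDomain Y ω := ⟨h.1, 0, h.zero_mem_subdiff⟩

/-- Zero is a subgradient at a minimizer, though `ω' y` need not vanish; extremality of the
selection gives `0 ≤ ⟨ω' y, z - y⟩`. -/
theorem IsProximalSetup.bregman_argmin_le [FiniteDimensional ℝ E] {Y : Set E}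
    {ν : Seminorm ℝ E} {ω : E → ℝ} {ω' : E → E} (hω : IsProximalSetup Y ν ω ω') {y z : E}
    (hy : IsArgmin Y ω y) (hz : z ∈ Y) : bregman ω ω' y z ≤ ω z - ω y := by
  have := hω.inner_le_selection hy.1 hy.zero_mem_subdiff hz
  rw [inner_zero_left] at this
  rw [bregman]
  linarith

theorem IsProximalSetup.argmin_unique [FiniteDimensional ℝ E] {Y : Set E}
    {ν : Seminorm ℝ E} {ω : E → ℝ} {ω' : E → E} (hω : IsProximalSetup Y ν ω ω') {y z : E}
    (hy : IsArgmin Y ω y) (hz : IsArgmin Y ω z) : z = y := by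
  have h1 := hω.sq_le_bregman hy.mem_subdiffDomain hz.1
  have h2 := hω.bregman_argmin_le hy hz.1
  have h3 := hz.2 y hy.1
  have h4 : ν (z - y) = 0 := by nlinarith
  exact sub_eq_zero.1 (hω.norm_definite _ h4)

/-! ### Prox steps on level sets -/

theorem affineAt_combo (g : E → E) (p x y : E) {a b : ℝ} (hab : a + b = 1) :
    affineAt g p (a • x + b • y) = a * affineAt g p x + b * affineAt g p y := by
  have : p - (a • x + b • y) = a • (p - x) + b • (p - y) := by
    have : p = (a + b) • p := by rw [hab, one_smul]
    conv_lhs => rw [this]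
    module
  rw [affineAt, this, inner_add_right, inner_smul_right, inner_smul_right, affineAt, affineAt]

theorem convexOn_const_sub_affineAt {Y : Set E} (hY : Convex ℝ Y) (g : E → E) (p : E) (c : ℝ) :
    ConvexOn ℝ Y fun z => c - affineAt g p z := by
  refine ⟨hY, fun x _ y _ a b _ _ hab => le_of_eq ?_⟩
  simp only [affineAt_combo g p x y hab, smul_eq_mul]
  linear_combination (-c) * hab

theorem affineAt_sub (g : E → E) (p x z : E) :
    affineAt g p z - affineAt g p x = - inner ℝ (g p) (z - x) := by
  rw [affineAt, affineAt, ← inner_sub_right, ← inner_neg_right]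
  congr 1
  abel

theorem continuous_affineAt (g : E → E) (p : E) : Continuous (affineAt g p) := by
  unfold affineAt
  fun_prop

/-- Optimality conditions for prox steps on level sets that satisfy the Slater condition. -/
theorem IsProximalSetup.argmin_levelSet [FiniteDimensional ℝ E] {Y : Set E}
    {ν : Seminorm ℝ E} {ω : E → ℝ} {ω' : E → E} (hω : IsProximalSetup Y ν ω ω') {g : E → E}
    {I : Finset ℕ} {p : ℕ → E} {c : ℝ} {ξ x : E}
    (hS : ∃ u ∈ Y, ∀ τ ∈ I, c < affineAt g (p τ) u)
    (hx : IsArgmin {z ∈ Y | ∀ τ ∈ I, c ≤ affineAt g (p τ) z} (fun z => ω z - inner ℝ ξ z) x) :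
    x ∈ subdiffDomain Y ω ∧
      ∀ u ∈ Y, (∀ τ ∈ I, c ≤ affineAt g (p τ) u) → 0 ≤ inner ℝ (ω' x - ξ) (u - x) := by
  obtain ⟨u₀, hu₀, hslater⟩ := hS
  have hY := hω.convexOn.1
  have hobj : ConvexOn ℝ Y fun z => (ω z - inner ℝ ξ z) - (ω x - inner ℝ ξ x) := by
    refine ⟨hY, fun a ha b hb s t hs ht hst => ?_⟩
    have := hω.convexOn.2 ha hb hs ht hst
    simp only [smul_eq_mul, inner_add_right, inner_smul_right] at *
    linear_combination this + (ω x - inner ℝ ξ x) * hst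
  -- Lagrange multipliers: a point where all these functions are negative would be feasible and
  -- better than `x`. The index `none` stands for the objective.
  obtain ⟨μ, hμ0, hμ1, hμ⟩ := exists_weights_of_forall_exists_nonneg (ι := Option I) ⟨u₀, hu₀⟩
    (Φ := fun i z => i.elim ((ω z - inner ℝ ξ z) - (ω x - inner ℝ ξ x))
      fun τ => c - affineAt g (p τ) z)
    (by
      rintro (_ | τ)
      · exact hobj
      · exact convexOn_const_sub_affineAt hY g _ c)
    (by
      intro z hz
      by_contra! hneg
      have h1 := hneg none
      simp only [Option.elim_none] at h1
      have h2 := hx.2 z ⟨hz, fun τ hτ => by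
        have := hneg (some ⟨τ, hτ⟩)
        simp only [Option.elim_some] at this
        linarith⟩
      simp only at h2
      linarith)
  simp only [Fintype.sum_option, Option.elim_none, Option.elim_some] at hμ1 hμ
  -- Slater's condition: without the objective, the weighted sum would be negative at `u₀`.
  have hpos : 0 < μ none := by
    refine lt_of_le_of_ne (hμ0 none) fun h0 => ?_
    have h1 := hμ u₀ hu₀
    rw [← h0, zero_mul, zero_add] at h1
    rw [← h0, zero_add] at hμ1
    have h2 : ∀ τ ∈ (Finset.univ : Finset I), μ (some τ) * (c - affineAt g (p τ) u₀) ≤ 0 :=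
      fun τ _ => mul_nonpos_of_nonneg_of_nonpos (hμ0 _) (by linarith [hslater τ τ.2])
    have h3 := (Finset.sum_eq_zero_iff_of_nonpos h2).1 (le_antisymm (Finset.sum_nonpos h2) h1)
    have h4 : ∑ τ : I, μ (some τ) = 0 := Finset.sum_eq_zero fun τ hτ => by
      rcases mul_eq_zero.1 (h3 τ hτ) with h | h
      · exact h
      · linarith [hslater τ τ.2]
    linarith
  -- Complementary slackness, from the multiplier inequality at `x` itself.
  have hslack : ∑ τ : I, μ (some τ) * (c - affineAt g (p τ) x) = 0 := by
    refine le_antisymm (Finset.sum_nonpos fun τ _ =>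
      mul_nonpos_of_nonneg_of_nonpos (hμ0 _) (by linarith [hx.1.2 τ τ.2])) ?_
    simpa using hμ x hx.1.1
  set G : E := ∑ τ : I, μ (some τ) • g (p τ) with hG
  have hGsum : ∀ z, inner ℝ G (z - x) = ∑ τ : I, μ (some τ) * (c - affineAt g (p τ) z) := by
    intro z
    rw [← sub_zero (∑ τ : I, μ (some τ) * (c - affineAt g (p τ) z)), ← hslack,
      ← Finset.sum_sub_distrib, hG, sum_inner]
    refine Finset.sum_congr rfl fun τ _ => ?_
    rw [real_inner_smul_left]
    linear_combination μ (some τ) * affineAt_sub g (p τ) x z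
  have hsub : ξ - (μ none)⁻¹ • G ∈ subdiff Y ω x := by
    intro z hz
    have h1 := hμ z hz
    rw [← hGsum] at h1
    have h2 : 0 ≤ (ω z - inner ℝ ξ z) - (ω x - inner ℝ ξ x) + (μ none)⁻¹ * inner ℝ G (z - x) := by
      have := mul_nonneg (inv_nonneg.2 hpos.le) h1
      rwa [mul_add, inv_mul_cancel_left₀ hpos.ne'] at this
    rw [inner_sub_left, real_inner_smul_left, inner_sub_right ξ]
    linarith
  refine ⟨⟨hx.1.1, _, hsub⟩, fun u hu hIu => ?_⟩
  have h1 := hω.inner_le_selection hx.1.1 hsub hu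
  have h2 : inner ℝ G (u - x) ≤ 0 := by
    rw [hGsum]
    exact Finset.sum_nonpos fun τ _ =>
      mul_nonpos_of_nonneg_of_nonpos (hμ0 _) (by linarith [hIu τ τ.2])
  rw [inner_sub_left, real_inner_smul_left] at h1
  rw [inner_sub_left]
  have := mul_nonpos_of_nonneg_of_nonpos (inv_nonneg.2 hpos.le) h2
  linarith

/-- The optimality condition at `x`, tested at `x'`, bounds `bregman ω ω' x x'` by the difference of
the objective values, which is at most 0. -/
theorem IsProximalSetup.argmin_levelSet_unique [FiniteDimensional ℝ E] {Y : Set E}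
    {ν : Seminorm ℝ E} {ω : E → ℝ} {ω' : E → E} (hω : IsProximalSetup Y ν ω ω') {g : E → E}
    {I : Finset ℕ} {p : ℕ → E} {c : ℝ} {ξ x x' : E}
    (hS : ∃ u ∈ Y, ∀ τ ∈ I, c < affineAt g (p τ) u)
    (hx : IsArgmin {z ∈ Y | ∀ τ ∈ I, c ≤ affineAt g (p τ) z} (fun z => ω z - inner ℝ ξ z) x)
    (hx' : IsArgmin {z ∈ Y | ∀ τ ∈ I, c ≤ affineAt g (p τ) z} (fun z => ω z - inner ℝ ξ z) x') :
    x' = x := by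
  obtain ⟨hxo, hopt⟩ := hω.argmin_levelSet hS hx
  have h1 := hopt x' hx'.1.1 hx'.1.2
  have h2 := hω.sq_le_bregman hxo hx'.1.1
  have h3 := hx'.2 x hx.1
  simp only at h3
  rw [inner_sub_left, inner_sub_right ξ] at h1
  rw [bregman] at h2
  have h4 : ν (x' - x) = 0 := by nlinarith
  exact sub_eq_zero.1 (hω.norm_definite _ h4)

theorem exists_argmin_levelSet {Y : Set E} (hY : IsCompact Y) {ω : E → ℝ}
    (hω : ContinuousOn ω Y) {g : E → E} {I : Finset ℕ} {p : ℕ → E} {c : ℝ} (ξ : E)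
    (hS : ∃ u ∈ Y, ∀ τ ∈ I, c < affineAt g (p τ) u) :
    ∃ x, IsArgmin {z ∈ Y | ∀ τ ∈ I, c ≤ affineAt g (p τ) z} (fun z => ω z - inner ℝ ξ z) x := by
  obtain ⟨u, hu, hIu⟩ := hS
  have hcl : IsClosed {z : E | ∀ τ ∈ I, c ≤ affineAt g (p τ) z} := by
    simp only [Set.ofPred_forall]
    exact isClosed_biInter fun τ _ => isClosed_le continuous_const (continuous_affineAt g _)
  have hco : ContinuousOn (fun z => ω z - inner ℝ ξ z)
      (Y ∩ {z : E | ∀ τ ∈ I, c ≤ affineAt g (p τ) z}) := by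
    have := hω.mono (Set.inter_subset_left (t := {z : E | ∀ τ ∈ I, c ≤ affineAt g (p τ) z}))
    fun_prop
  obtain ⟨x, hx, hmin⟩ := (hY.inter_right hcl).exists_isMinOn
    ⟨u, hu, fun τ hτ => (hIu τ hτ).le⟩ hco
  exact ⟨x, hx, fun z hz => hmin hz⟩

end MDL

namespace MDL

variable {E : Type*} [NormedAddCommGroup E] [InnerProductSpace ℝ E]

/-! ### The auxiliary problem -/

theorem exists_solvesAux {Y : Set E} (hY : IsCompact Y) (hYne : Y.Nonempty)
    (hYc : Convex ℝ Y) (g : E → E) (σ : State E) : ∃ e lam, SolvesAux Y g σ e lam := by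
  classical
  have hne : σ.Iplus.Nonempty := Finset.insert_nonempty _ _
  obtain ⟨z₀, hz₀, hmax⟩ := hY.exists_isMaxOn hYne
    (Continuous.finset_inf'_apply hne
      fun τ _ => continuous_affineAt g (σ.y τ)).continuousOn
  set e := σ.Iplus.inf' hne fun τ => affineAt g (σ.y τ) z₀ with he
  -- At every point some cut is at most the maximin value `e`, so the alternative applies to the
  -- functions `e - h_τ`.
  obtain ⟨c, hc0, hc1, hc⟩ := exists_weights_of_forall_exists_nonneg (ι := σ.Iplus) hYne
    (Φ := fun τ z => e - affineAt g (σ.y τ) z)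
    (fun τ => convexOn_const_sub_affineAt hYc g _ e) (fun z hz => by
      obtain ⟨τ, hτ, h⟩ := Finset.exists_mem_eq_inf' hne fun τ => affineAt g (σ.y τ) z
      have h1 : σ.Iplus.inf' hne (fun τ => affineAt g (σ.y τ) z) ≤ e := hmax hz
      exact ⟨⟨τ, hτ⟩, by simp only; linarith⟩)
  set lam : ℕ → ℝ := fun τ => if h : τ ∈ σ.Iplus then c ⟨τ, h⟩ else 0 with hlam
  have hsum : ∀ f : ℕ → ℝ, ∑ τ ∈ σ.Iplus, lam τ * f τ = ∑ τ : σ.Iplus, c τ * f τ := fun f => by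
    rw [← Finset.sum_coe_sort]
    exact Finset.sum_congr rfl fun τ _ => by simp [hlam]
  have hlam1 : ∑ τ ∈ σ.Iplus, lam τ = 1 := by
    have := hsum fun _ => 1
    simp only [mul_one] at this
    rw [this, hc1]
  have hle : ∀ z ∈ Y, ∑ τ ∈ σ.Iplus, lam τ * affineAt g (σ.y τ) z ≤ e := by
    intro z hz
    rw [hsum]
    have := hc z hz
    simp only [mul_sub, Finset.sum_sub_distrib, ← Finset.sum_mul, hc1, one_mul] at this
    linarith
  have hnn : ∀ τ, 0 ≤ lam τ := fun τ => by
    by_cases h : τ ∈ σ.Iplus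
    · simpa [hlam, h] using hc0 ⟨τ, h⟩
    · simp [hlam, h]
  refine ⟨e, lam, ⟨⟨z₀, hz₀, rfl⟩, ?_⟩, hnn, fun τ h => by simp [hlam, h], hlam1,
    ⟨z₀, hz₀, le_antisymm (hle z₀ hz₀) ?_⟩, ?_⟩
  · rintro _ ⟨z, hz, rfl⟩
    exact hmax hz
  · calc e = ∑ τ ∈ σ.Iplus, lam τ * e := by rw [← Finset.sum_mul, hlam1, one_mul]
      _ ≤ _ := Finset.sum_le_sum fun τ hτ => mul_le_mul_of_nonneg_left
        (Finset.inf'_le (fun τ => affineAt g (σ.y τ) z₀) hτ) (hnn τ)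
  · rintro _ ⟨z, hz, rfl⟩
    exact hle z hz

theorem SolvesAux.exists_le {Y : Set E} {g : E → E} {σ : State E} {e : ℝ} {lam : ℕ → ℝ}
    (h : SolvesAux Y g σ e lam) : ∃ u ∈ Y, ∀ τ ∈ σ.Iplus, e ≤ affineAt g (σ.y τ) u := by
  obtain ⟨u, hu, he⟩ := h.value.1
  exact ⟨u, hu, fun τ hτ => he ▸ Finset.inf'_le (fun τ => affineAt g (σ.y τ) u) hτ⟩

/-- Otherwise the weighted sum at `z` would exceed its maximum `e`. Hence dropping the indices of
zero weight leaves the minimum of the cuts at most `e` on `Y`. -/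
theorem SolvesAux.exists_ge {Y : Set E} {g : E → E} {σ : State E} {e : ℝ} {lam : ℕ → ℝ}
    (h : SolvesAux Y g σ e lam) {z : E} (hz : z ∈ Y) :
    ∃ τ ∈ σ.Iplus, 0 < lam τ ∧ affineAt g (σ.y τ) z ≤ e := by
  by_contra! hcon
  obtain ⟨τ₀, hτ₀, hne⟩ := Finset.exists_ne_zero_of_sum_ne_zero
    (by rw [h.sum_eq_one]; exact one_ne_zero : ∑ τ ∈ σ.Iplus, lam τ ≠ 0)
  have hpos₀ : 0 < lam τ₀ := lt_of_le_of_ne (h.nonneg τ₀) hne.symm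
  have h1 : ∑ τ ∈ σ.Iplus, lam τ * e < ∑ τ ∈ σ.Iplus, lam τ * affineAt g (σ.y τ) z := by
    refine Finset.sum_lt_sum (fun τ hτ => ?_)
      ⟨τ₀, hτ₀, mul_lt_mul_of_pos_left (hcon τ₀ hτ₀ hpos₀) hpos₀⟩
    rcases (h.nonneg τ).eq_or_lt with h0 | h0
    · simp [← h0]
    · exact (mul_lt_mul_of_pos_left (hcon τ hτ h0) h0).le
  rw [← Finset.sum_mul, h.sum_eq_one, one_mul] at h1
  exact absurd (h.weights.2 ⟨z, hz, rfl⟩) (not_le.2 h1)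

/-! ### Well-definedness of the steps -/

/-- The standing assumptions on the data of the method. -/
structure IsInstance (Y : Set E) (ν : Seminorm ℝ E) (ω : E → ℝ) (ω' : E → E) (g : E → E)
    (L γ ε : ℝ) (yω : E) : Prop where
  compact : IsCompact Y
  nonempty : Y.Nonempty
  setup : IsProximalSetup Y ν ω ω'
  bound : ∀ y ∈ Y, dualNorm ν (g y) ≤ L
  γ_pos : 0 < γ
  γ_lt_one : γ < 1
  ε_pos : 0 < ε
  center : IsArgmin Y ω yω

/-- Index sets and search points of a state are consistent. -/
structure IsConsistent (Y : Set E) (ω : E → ℝ) (yω : E) (σ : State E) : Prop where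
  one_mem : 1 ∈ σ.Iplus
  subset : σ.Iplus ⊆ Finset.Icc 1 σ.t
  mem_domain : ∀ τ ∈ Finset.Icc 1 σ.t, σ.y τ ∈ subdiffDomain Y ω
  y_one : σ.y 1 = yω

section

variable {Y : Set E} {ν : Seminorm ℝ E} {ω : E → ℝ} {ω' : E → E} {g : E → E} {L γ ε : ℝ}
  {yω : E} {σ σ' : State E} {e : ℝ} {lam : ℕ → ℝ}

theorem IsConsistent.t_mem (hσ : IsConsistent Y ω yω σ) : σ.t ∈ Finset.Icc 1 σ.t :=
  hσ.subset (Finset.mem_insert_self _ _)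

theorem IsConsistent.newI_subset (hσ : IsConsistent Y ω yω σ) (h : SolvesAux Y g σ e lam) :
    newI γ σ e lam ⊆ σ.Iplus := by
  intro τ hτ
  unfold newI at hτ
  split_ifs at hτ
  · rcases Finset.mem_union.1 hτ with hτ | hτ
    · by_contra hn
      exact (Finset.mem_filter.1 hτ).2.ne' (h.support τ hn)
    · rw [Finset.mem_singleton.1 hτ]
      exact hσ.one_mem
  · exact hτ

theorem IsConsistent.one_mem_newI (hσ : IsConsistent Y ω yω σ) : 1 ∈ newI γ σ e lam := by
  unfold newI
  split_ifs
  · simp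
  · exact hσ.one_mem

/-- The reason for keeping index 1 when a phase starts: the cut generated at the prox center is
always a constraint of the level set. -/
theorem IsConsistent.exists_proxCenter_eq (hσ : IsConsistent Y ω yω σ) :
    ∃ τ ∈ newI γ σ e lam, τ ∈ Finset.Icc 1 σ.t ∧ proxCenter γ yω σ e = σ.y τ := by
  by_cases hs : StartsPhase γ σ e
  · exact ⟨1, hσ.one_mem_newI, hσ.subset hσ.one_mem, by simp [proxCenter, hs, hσ.y_one]⟩
  · exact ⟨σ.t, by simp [newI, hs, State.Iplus], hσ.t_mem, by simp [proxCenter, hs]⟩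

theorem IsConsistent.proxCenter_mem (hσ : IsConsistent Y ω yω σ) :
    proxCenter γ yω σ e ∈ subdiffDomain Y ω := by
  obtain ⟨τ, -, hτ, heq⟩ := hσ.exists_proxCenter_eq (γ := γ) (e := e) (lam := 0)
  exact heq ▸ hσ.mem_domain τ hτ

/-- A maximizer of the auxiliary problem has all cuts at least `e`, and `γ e < e` since `e > ε > 0`.
-/
theorem IsInstance.slater (H : IsInstance Y ν ω ω' g L γ ε yω) (hσ : IsConsistent Y ω yω σ)
    (h : SolvesAux Y g σ e lam) (he : ε < e) :
    ∃ u ∈ Y, ∀ τ ∈ newI γ σ e lam, γ * e < affineAt g (σ.y τ) u := by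
  obtain ⟨u, hu, hmax⟩ := h.exists_le
  refine ⟨u, hu, fun τ hτ => lt_of_lt_of_le ?_ (hmax τ (hσ.newI_subset h hτ))⟩
  nlinarith [H.ε_pos, H.γ_lt_one]

theorem IsInstance.existsUnique_step [FiniteDimensional ℝ E]
    (H : IsInstance Y ν ω ω' g L γ ε yω) (hσ : IsConsistent Y ω yω σ)
    (h : SolvesAux Y g σ e lam) (he : ε < e) :
    ∃! σ', Step Y ω ω' g γ ε yω σ e lam σ' := by
  classical
  have hS := H.slater hσ h he
  obtain ⟨x, hx⟩ := exists_argmin_levelSet H.compact H.setup.continuousOn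
    (ω' (proxCenter γ yω σ e)) hS
  refine ⟨⟨σ.t + 1, Function.update σ.y (σ.t + 1) x, newI γ σ e lam, newGap γ σ e⟩,
    ⟨h, he, hσ.proxCenter_mem, rfl, fun τ hτ => Function.update_of_ne hτ _ _, ?_, rfl, rfl⟩, ?_⟩
  · simp only [Function.update_self]
    exact hx
  · rintro ⟨t, y, I, gap⟩ hst
    have h1 := hst.t_eq
    have h2 := hst.I_eq
    have h3 := hst.gap_eq
    simp only at h1 h2 h3
    subst h1 h2 h3
    congr 1
    funext τ
    by_cases hτ : τ = σ.t + 1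
    · subst hτ
      rw [Function.update_self]
      exact H.setup.argmin_levelSet_unique hS hx hst.y_new
    · rw [Function.update_of_ne hτ]
      exact hst.y_old τ hτ

theorem Step.y_eq (h : Step Y ω ω' g γ ε yω σ e lam σ') {τ : ℕ} (hτ : τ ∈ Finset.Icc 1 σ.t) :
    σ'.y τ = σ.y τ :=
  h.y_old τ (by have := (Finset.mem_Icc.1 hτ).2; omega)

theorem Step.isConsistent [FiniteDimensional ℝ E] (H : IsInstance Y ν ω ω' g L γ ε yω)
    (hσ : IsConsistent Y ω yω σ) (h : Step Y ω ω' g γ ε yω σ e lam σ') :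
    IsConsistent Y ω yω σ' := by
  have h1t := Finset.mem_Icc.1 hσ.t_mem
  refine ⟨?_, ?_, fun τ hτ => ?_, ?_⟩
  · exact Finset.mem_insert_of_mem (h.I_eq ▸ hσ.one_mem_newI)
  · intro τ hτ
    rw [h.t_eq, Finset.mem_Icc]
    rcases Finset.mem_insert.1 hτ with rfl | hτ
    · rw [h.t_eq]
      omega
    · rw [h.I_eq] at hτ
      have := Finset.mem_Icc.1 (hσ.subset (hσ.newI_subset h.solves hτ))
      omega
  · by_cases hτt : τ = σ.t + 1
    · subst hτt
      exact (H.setup.argmin_levelSet (H.slater hσ h.solves h.not_done) h.y_new).1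
    · have : τ ∈ Finset.Icc 1 σ.t := by
        rw [h.t_eq] at hτ
        rw [Finset.mem_Icc] at hτ ⊢
        omega
      rw [h.y_eq this]
      exact hσ.mem_domain τ this
  · rw [h.y_eq (Finset.mem_Icc.2 ⟨le_rfl, h1t.1⟩), hσ.y_one]

/-! ### Progress of a step and length of phases -/

/-- One prox step decreases the Bregman distance to all points of the level set. -/
theorem Step.bregman_add_le [FiniteDimensional ℝ E] (H : IsInstance Y ν ω ω' g L γ ε yω)
    (hσ : IsConsistent Y ω yω σ) (h : Step Y ω ω' g γ ε yω σ e lam σ') {u : E} (hu : u ∈ Y)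
    (hIu : ∀ τ ∈ newI γ σ e lam, γ * e ≤ affineAt g (σ.y τ) u) :
    4 * L ^ 2 * bregman ω ω' (σ'.y σ'.t) u + γ ^ 2 * e ^ 2 ≤
      4 * L ^ 2 * bregman ω ω' (proxCenter γ yω σ e) u := by
  rw [h.t_eq]
  obtain ⟨τ, hτI, hτ, heq⟩ := hσ.exists_proxCenter_eq (γ := γ) (e := e) (lam := lam)
  have hyo := h.center_mem
  have hnew := h.y_new
  set c := proxCenter γ yω σ e with hc
  set x := σ'.y (σ.t + 1) with hx
  have hopt := (H.setup.argmin_levelSet (H.slater hσ h.solves h.not_done) hnew).2 u hu hIu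
  have hlow := H.setup.sq_le_bregman hyo hnew.1.1
  -- The cut generated at `c` vanishes at `c` and is at least `γ e` at `x`.
  have hν : γ * e ≤ L * ν (x - c) := by
    have h1 : γ * e ≤ affineAt g (σ.y τ) x := hnew.1.2 τ hτI
    rw [← heq, affineAt] at h1
    have h2 := inner_le_dualNorm_mul H.setup.norm_definite (g c) (c - x)
    rw [map_sub_rev] at h2
    have h3 := mul_le_mul_of_nonneg_right (H.bound c hyo.1) (apply_nonneg ν (x - c))
    linarith
  have hsq : γ ^ 2 * e ^ 2 ≤ L ^ 2 * ν (x - c) ^ 2 := by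
    rw [← mul_pow, ← mul_pow]
    exact pow_le_pow_left₀ (mul_nonneg H.γ_pos.le (H.ε_pos.trans h.not_done).le) hν 2
  have hthree : bregman ω ω' x u + bregman ω ω' c x ≤ bregman ω ω' c u := by
    rw [inner_sub_left] at hopt
    have : inner ℝ (ω' c) (u - c) = inner ℝ (ω' c) (u - x) + inner ℝ (ω' c) (x - c) := by
      rw [← inner_add_right]
      congr 1
      abel
    simp only [bregman]
    linarith
  have h4 := mul_le_mul_of_nonneg_left hlow (sq_nonneg L)
  have h5 := mul_le_mul_of_nonneg_left hthree (by positivity : 0 ≤ 4 * L ^ 2)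
  linarith

theorem IsInstance.le_omegaDiam_sq [FiniteDimensional ℝ E] (H : IsInstance Y ν ω ω' g L γ ε yω) {u : E}
    (hu : u ∈ Y) : 2 * (ω u - ω yω) ≤ omegaDiam Y ω ^ 2 := by
  have hcomp := H.compact.image_of_continuousOn H.setup.continuousOn
  have h1 : ω u ≤ sSup (ω '' Y) := le_csSup hcomp.bddAbove ⟨u, hu, rfl⟩
  have h2 : sInf (ω '' Y) ≤ ω yω := csInf_le hcomp.bddBelow ⟨yω, H.center.1, rfl⟩
  have h3 := H.center.2 u hu
  rw [omegaDiam, Real.sq_sqrt (by linarith)]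
  linarith

theorem IsInstance.bregman_center_le [FiniteDimensional ℝ E]
    (H : IsInstance Y ν ω ω' g L γ ε yω) {u : E} (hu : u ∈ Y) :
    4 * L ^ 2 * bregman ω ω' yω u ≤ 2 * omegaDiam Y ω ^ 2 * L ^ 2 := by
  have h1 := H.setup.bregman_argmin_le H.center hu
  have h2 := H.le_omegaDiam_sq hu
  have h3 : 2 * bregman ω ω' yω u ≤ omegaDiam Y ω ^ 2 := by linarith
  linarith [mul_le_mul_of_nonneg_left h3 (sq_nonneg L)]

/-- A state entered after `p` steps of a phase with gap `Δ`. -/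
structure InPhase (Y : Set E) (ω : E → ℝ) (ω' : E → E) (g : E → E) (L γ ε : ℝ)
    (σ : State E) (Δ : ℝ) (p : ℕ) : Prop where
  gap_eq : σ.gap = (Δ : EReal)
  lt_gap : ε < Δ
  -- Of the `t - 1` steps made, `t - 1 - p` belong to earlier phases; this bound carries the
  -- geometric series through the induction.
  earlier : ((σ.t : ℝ) - 1 - p) * (γ ^ 4 * (1 - γ ^ 2) * Δ ^ 2) ≤
    2 * omegaDiam Y ω ^ 2 * L ^ 2 * γ ^ 2
  exists_common : ∃ u ∈ Y, ∀ τ ∈ σ.I, γ * Δ ≤ affineAt g (σ.y τ) u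
  exists_le : ∀ z ∈ Y, ∃ τ ∈ σ.I, affineAt g (σ.y τ) z ≤ Δ
  bregman_le : ∀ u ∈ Y, (∀ τ ∈ σ.I, γ * Δ ≤ affineAt g (σ.y τ) u) →
    4 * L ^ 2 * bregman ω ω' (σ.y σ.t) u + p * (γ ^ 4 * Δ ^ 2) ≤ 2 * omegaDiam Y ω ^ 2 * L ^ 2

/-- The invariant of the method: no step has been made, or a phase is under way. -/
structure Invariant (Y : Set E) (ω : E → ℝ) (ω' : E → E) (g : E → E) (L γ ε : ℝ) (yω : E)
    (σ : State E) : Prop where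
  consistent : IsConsistent Y ω yω σ
  phase : (σ.t = 1 ∧ σ.gap = ⊤) ∨ ∃ Δ p, InPhase Y ω ω' g L γ ε σ Δ p

/-- Nonnegativity of the Bregman distance at a common point bounds `p`; after scaling, the shares `1
- γ²` of this phase and `γ²` of the earlier ones add up to 1. -/
theorem InPhase.steps_le [FiniteDimensional ℝ E] (H : IsInstance Y ν ω ω' g L γ ε yω)
    (hσ : IsConsistent Y ω yω σ) {Δ : ℝ} {p : ℕ} (h : InPhase Y ω ω' g L γ ε σ Δ p) :
    ((σ.t : ℝ) - 1) * (γ ^ 4 * (1 - γ ^ 2) * Δ ^ 2) ≤ 2 * omegaDiam Y ω ^ 2 * L ^ 2 := by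
  obtain ⟨u, hu, hIu⟩ := h.exists_common
  have h1 := h.bregman_le u hu hIu
  have h2 := H.setup.sq_le_bregman (hσ.mem_domain _ hσ.t_mem) hu
  have h3 : 0 ≤ 4 * L ^ 2 * bregman ω ω' (σ.y σ.t) u := by
    have : 0 ≤ bregman ω ω' (σ.y σ.t) u := by nlinarith [sq_nonneg (ν (u - σ.y σ.t))]
    positivity
  have h4 : (p : ℝ) * (γ ^ 4 * Δ ^ 2) ≤ 2 * omegaDiam Y ω ^ 2 * L ^ 2 := by linarith
  have h5 : 0 ≤ 1 - γ ^ 2 := by nlinarith [H.γ_pos, H.γ_lt_one]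
  have h6 := mul_le_mul_of_nonneg_right h4 h5
  have h7 := h.earlier
  linarith

theorem Step.invariant [FiniteDimensional ℝ E] (H : IsInstance Y ν ω ω' g L γ ε yω)
    (hσ : Invariant Y ω ω' g L γ ε yω σ) (h : Step Y ω ω' g γ ε yω σ e lam σ') :
    Invariant Y ω ω' g L γ ε yω σ' := by
  have hγ := H.γ_pos
  have hγ1 := H.γ_lt_one
  have he : 0 < e := H.ε_pos.trans h.not_done
  have hC := hσ.consistent
  have hγsq : 0 ≤ 1 - γ ^ 2 := by nlinarith
  have hyeq : ∀ τ ∈ newI γ σ e lam, σ'.y τ = σ.y τ := fun τ hτ =>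
    h.y_eq (hC.subset (hC.newI_subset h.solves hτ))
  refine ⟨h.isConsistent H hC, Or.inr ?_⟩
  obtain ⟨w, hw, hIw⟩ := h.solves.exists_le
  by_cases hs : StartsPhase γ σ e
  · have hcenter : proxCenter γ yω σ e = yω := by simp [proxCenter, hs]
    -- The step that starts the phase is counted in it, so `p = 1`.
    refine ⟨e, 1, by rw [h.gap_eq, newGap, if_pos hs], h.not_done, ?_, ⟨w, hw, fun τ hτ => ?_⟩,
      fun z hz => ?_, fun u hu hIu => ?_⟩
    · have hrhs : 0 ≤ 2 * omegaDiam Y ω ^ 2 * L ^ 2 * γ ^ 2 := by positivity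
      rw [h.t_eq]
      push_cast
      rw [show (σ.t : ℝ) + 1 - 1 - 1 = σ.t - 1 by ring]
      rcases hσ.phase with ⟨ht, -⟩ | ⟨Δ, p, hP⟩
      · simpa [ht] using hrhs
      · have h1 := hP.steps_le H hC
        have h2 : e ≤ γ * Δ := by
          unfold StartsPhase at hs
          rw [hP.gap_eq] at hs
          exact_mod_cast hs
        -- The drop of the gap supplies the factor `γ²` that turns the bound on all previous steps
        -- into `earlier` for the new phase.
        have h3 : e ^ 2 ≤ γ ^ 2 * Δ ^ 2 := by
          rw [← mul_pow]
          exact pow_le_pow_left₀ he.le h2 2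
        have ht : 0 ≤ (σ.t : ℝ) - 1 := by
          have := (Finset.mem_Icc.1 hC.t_mem).1
          have : (1 : ℝ) ≤ σ.t := by exact_mod_cast this
          linarith
        have h4 : 0 ≤ ((σ.t : ℝ) - 1) * (γ ^ 4 * (1 - γ ^ 2)) := by positivity
        have h5 := mul_le_mul_of_nonneg_left h3 h4
        have h6 := mul_le_mul_of_nonneg_right h1 (sq_nonneg γ)
        linarith
    · rw [h.I_eq] at hτ
      rw [hyeq τ hτ]
      refine le_trans ?_ (hIw τ (hC.newI_subset h.solves hτ))
      nlinarith
    · obtain ⟨τ, hτ, hpos, hle⟩ := h.solves.exists_ge hz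
      have hτI : τ ∈ newI γ σ e lam := by
        rw [newI, if_pos hs]
        exact Finset.mem_union_left _ (Finset.mem_filter.2 ⟨hC.subset hτ, hpos⟩)
      exact ⟨τ, h.I_eq ▸ hτI, by rwa [hyeq τ hτI]⟩
    · have h1 := h.bregman_add_le H hC hu fun τ hτ => by
        rw [← hyeq τ hτ]
        exact hIu τ (h.I_eq ▸ hτ)
      rw [hcenter] at h1
      have h2 := H.bregman_center_le hu
      have h3 : γ ^ 4 * e ^ 2 ≤ γ ^ 2 * e ^ 2 := by
        have := mul_nonneg (mul_nonneg (sq_nonneg γ) (sq_nonneg e)) hγsq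
        linarith
      push_cast
      linarith
  · have hcenter : proxCenter γ yω σ e = σ.y σ.t := by simp [proxCenter, hs]
    have hnewI : newI γ σ e lam = σ.Iplus := by simp [newI, hs]
    rcases hσ.phase with ⟨-, htop⟩ | ⟨Δ, p, hP⟩
    -- With gap `+∞` the test always succeeds, so the first step starts a phase.
    · refine absurd ?_ hs
      rw [StartsPhase, htop, EReal.coe_mul_top_of_pos hγ]
      exact le_top
    have hI : σ.I ⊆ newI γ σ e lam := hnewI ▸ Finset.subset_insert _ _
    have hΔ : 0 < Δ := H.ε_pos.trans hP.lt_gap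
    have hgt : γ * Δ < e := by
      by_contra! hle
      refine hs ?_
      rw [StartsPhase, hP.gap_eq]
      exact_mod_cast hle
    have hle : e ≤ Δ := by
      obtain ⟨τ, hτ, hτΔ⟩ := hP.exists_le w hw
      exact (hIw τ (Finset.mem_insert_of_mem hτ)).trans hτΔ
    refine ⟨Δ, p + 1, by rw [h.gap_eq, newGap, if_neg hs, hP.gap_eq], hP.lt_gap, ?_,
      ⟨w, hw, fun τ hτ => ?_⟩, fun z hz => ?_, fun u hu hIu => ?_⟩
    · rw [h.t_eq]
      push_cast
      rw [show (σ.t : ℝ) + 1 - 1 - (p + 1) = σ.t - 1 - p by ring]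
      exact hP.earlier
    · rw [h.I_eq] at hτ
      rw [hyeq τ hτ]
      exact hgt.le.trans (hIw τ (hC.newI_subset h.solves hτ))
    · obtain ⟨τ, hτ, hτΔ⟩ := hP.exists_le z hz
      exact ⟨τ, h.I_eq ▸ hI hτ, by rwa [hyeq τ (hI hτ)]⟩
    · have hIu' : ∀ τ ∈ newI γ σ e lam, γ * Δ ≤ affineAt g (σ.y τ) u := fun τ hτ => by
        rw [← hyeq τ hτ]
        exact hIu τ (h.I_eq ▸ hτ)
      -- Since `e ≤ Δ`, the point `u` lies in the current level set, whose level is `γ e`.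
      have h1 := h.bregman_add_le H hC hu fun τ hτ =>
        (mul_le_mul_of_nonneg_left hle hγ.le).trans (hIu' τ hτ)
      rw [hcenter] at h1
      have h2 := hP.bregman_le u hu fun τ hτ => hIu' τ (hI hτ)
      have h3 : γ ^ 4 * Δ ^ 2 ≤ γ ^ 2 * e ^ 2 := by
        have := pow_le_pow_left₀ (mul_pos hγ hΔ).le hgt.le 2
        rw [mul_pow] at this
        linarith [mul_le_mul_of_nonneg_left this (sq_nonneg γ)]
      push_cast
      linarith

theorem IsInstance.invariant [FiniteDimensional ℝ E] (H : IsInstance Y ν ω ω' g L γ ε yω)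
    (hr : Reachable Y ω ω' g γ ε yω σ) : Invariant Y ω ω' g L γ ε yω σ := by
  induction hr with
  | init =>
    refine ⟨⟨?_, ?_, fun τ _ => H.center.mem_subdiffDomain, rfl⟩, Or.inl ⟨rfl, rfl⟩⟩ <;>
    simp [State.Iplus, initState]
  | step _ hst ih => exact hst.invariant H ih

/-- The phase bound with `Δ > ε` counts the `t - 1` completed steps; the summand 1 is the step being
entered. -/
theorem IsInstance.t_le [FiniteDimensional ℝ E] (H : IsInstance Y ν ω ω' g L γ ε yω)
    (hr : Reachable Y ω ω' g γ ε yω σ) :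
    (σ.t : ℝ) ≤ 2 * omegaDiam Y ω ^ 2 * L ^ 2 / (γ ^ 4 * (1 - γ ^ 2) * ε ^ 2) + 1 := by
  have hσ := H.invariant hr
  have hγ := H.γ_pos
  have hε := H.ε_pos
  have hγsq : 0 < 1 - γ ^ 2 := by nlinarith [H.γ_lt_one]
  rcases hσ.phase with ⟨ht, -⟩ | ⟨Δ, p, hP⟩
  · rw [ht]
    have : 0 ≤ 2 * omegaDiam Y ω ^ 2 * L ^ 2 / (γ ^ 4 * (1 - γ ^ 2) * ε ^ 2) := by positivity
    push_cast
    linarith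
  · rw [← sub_le_iff_le_add, le_div_iff₀ (by positivity)]
    refine le_trans ?_ (hP.steps_le H hσ.consistent)
    have ht : 0 ≤ (σ.t : ℝ) - 1 := by
      have := (Finset.mem_Icc.1 hσ.consistent.t_mem).1
      have : (1 : ℝ) ≤ σ.t := by exact_mod_cast this
      linarith
    have := hP.lt_gap.le
    gcongr

theorem SolvesAux.isGreatest_certificateValues (h : SolvesAux Y g σ e lam)
    (hsub : σ.Iplus ⊆ Finset.Icc 1 σ.t) :
    IsGreatest (certificateValues Y g σ.t σ.y lam) e := by
  have hsum : ∀ z, ∑ τ ∈ Finset.Icc 1 σ.t, lam τ * affineAt g (σ.y τ) z =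
      ∑ τ ∈ σ.Iplus, lam τ * affineAt g (σ.y τ) z := fun z =>
    (Finset.sum_subset hsub fun τ _ hτ => by rw [h.support τ hτ, zero_mul]).symm
  simp only [certificateValues, hsum]
  exact h.weights

end

end MDL

/-! ### The main theorem -/

theorem proposition5 {E : Type*} [NormedAddCommGroup E] [InnerProductSpace ℝ E]
    [FiniteDimensional ℝ E] (Y : Set E) (hY : IsCompact Y) (hYne : Y.Nonempty)
    (hYconv : Convex ℝ Y)
    (ν : Seminorm ℝ E) (ω : E → ℝ) (ω' : E → E) (hω : MDL.IsProximalSetup Y ν ω ω')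
    (g : E → E) (L : ℝ) (hg : ∀ y ∈ Y, MDL.dualNorm ν (g y) ≤ L)
    (γ : ℝ) (hγ : γ ∈ Set.Ioo (0 : ℝ) 1) (ε : ℝ) (hε : 0 < ε) :
    -- the `ω`-center is well defined
    (∃! yω, MDL.IsArgmin Y ω yω) ∧
    ∀ yω, MDL.IsArgmin Y ω yω →
      -- every step that is entered can be carried out: the auxiliary problem has a solution, and
      -- unless its value is at most `ε`, the next search point exists and is unique
      (∀ σ, MDL.Reachable Y ω ω' g γ ε yω σ →
        (∃ e lam, MDL.SolvesAux Y g σ e lam) ∧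
        ∀ e lam, MDL.SolvesAux Y g σ e lam → ε < e →
          ∃! σ', MDL.Step Y ω ω' g γ ε yω σ e lam σ') ∧
      -- the number of steps obeys the bound
      (∀ σ, MDL.Reachable Y ω ω' g γ ε yω σ →
        (σ.t : ℝ) ≤
          2 * MDL.omegaDiam Y ω ^ 2 * L ^ 2 / (γ ^ 4 * (1 - γ ^ 2) * ε ^ 2) + 1) ∧
      -- there is no infinite run, and there is a run that terminates
      (¬ ∃ σ : ℕ → MDL.State E, σ 0 = MDL.initState yω ∧
        ∀ n, ∃ e lam, MDL.Step Y ω ω' g γ ε yω (σ n) e lam (σ (n + 1))) ∧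
      (∃ σ lam, MDL.TerminatesAt Y ω ω' g γ ε yω σ lam) ∧
      -- every output is an execution protocol with a certificate of resolution at most `ε`
      (∀ σ lam, MDL.TerminatesAt Y ω ω' g γ ε yω σ lam →
        (∀ τ ∈ Finset.Icc 1 σ.t, σ.y τ ∈ Y) ∧
        MDL.IsCertificate σ.t lam ∧
        IsGreatest (MDL.certificateValues Y g σ.t σ.y lam)
          (MDL.resolution Y g σ.t σ.y lam) ∧
        MDL.resolution Y g σ.t σ.y lam ≤ ε) := by
  have hcenter : ∃ yω, MDL.IsArgmin Y ω yω := by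
    obtain ⟨x, hx, hmin⟩ := hY.exists_isMinOn hYne hω.continuousOn
    exact ⟨x, hx, fun z hz => hmin hz⟩
  refine ⟨?_, fun yω hyω => ?_⟩
  · obtain ⟨x, hx⟩ := hcenter
    exact ⟨x, hx, fun z hz => hω.argmin_unique hx hz⟩
  have H : MDL.IsInstance Y ν ω ω' g L γ ε yω := ⟨hY, hYne, hω, hg, hγ.1, hγ.2, hε, hyω⟩
  have hsolve := MDL.exists_solvesAux hY hYne hYconv g
  -- An infinite run, or the absence of terminating runs, would make every step number reachable.
  have hlong : ¬ ∀ n : ℕ, ∃ σ, MDL.Reachable Y ω ω' g γ ε yω σ ∧ σ.t = n + 1 := by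
    intro hall
    obtain ⟨n, hn⟩ := exists_nat_gt
      (2 * MDL.omegaDiam Y ω ^ 2 * L ^ 2 / (γ ^ 4 * (1 - γ ^ 2) * ε ^ 2))
    obtain ⟨σ, hσ, ht⟩ := hall n
    have := H.t_le hσ
    rw [ht] at this
    push_cast at this
    linarith
  refine ⟨fun σ hσ => ⟨hsolve σ, fun e lam h he =>
    H.existsUnique_step (H.invariant hσ).consistent h he⟩, fun σ hσ => H.t_le hσ, ?_, ?_, ?_⟩
  · rintro ⟨σ, h0, hstep⟩
    refine hlong fun n => ⟨σ n, ?_⟩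
    induction n with
    | zero => rw [h0]; exact ⟨.init, rfl⟩
    | succ n ih =>
      obtain ⟨e, lam, hst⟩ := hstep n
      exact ⟨.step ih.1 hst, by rw [hst.t_eq, ih.2]⟩
  · by_contra! hterm
    refine hlong fun n => ?_
    induction n with
    | zero => exact ⟨_, .init, rfl⟩
    | succ n ih =>
      obtain ⟨σ, hσ, ht⟩ := ih
      obtain ⟨e, lam, hsol⟩ := hsolve σ
      have he : ε < e := by
        by_contra! hle
        exact hterm σ lam ⟨hσ, e, hsol, hle⟩
      obtain ⟨σ', hst, -⟩ := H.existsUnique_step (H.invariant hσ).consistent hsol he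
      exact ⟨σ', .step hσ hst, by rw [hst.t_eq, ht]⟩
  · rintro σ lam ⟨hσ, e, hsol, hle⟩
    have hC := (H.invariant hσ).consistent
    have hgr := hsol.isGreatest_certificateValues hC.subset
    have hres : MDL.resolution Y g σ.t σ.y lam = e := hgr.csSup_eq
    refine ⟨fun τ hτ => (hC.mem_domain τ hτ).1, ⟨fun τ _ => hsol.nonneg τ, ?_⟩, ?_, ?_⟩
    · rw [← hsol.sum_eq_one]
      exact (Finset.sum_subset hC.subset fun τ _ hτ => hsol.support τ hτ).symm
    · rwa [hres]
    · rwa [hres]
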